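/- Let $3\le\alpha<\omega$. Consider first-order logic with equality whose individual variables are $v_i$ ($i<\alpha$), whose logical connectives are $\lor$, $\neg$, $\exists v_i$ and $v_i=v_j$ ($i,j<\alpha$), and whose vocabulary consists of infinitely many $\alpha$-place relation symbols and possibly further relation symbols of smaller arity, with no function or constant symbols. Let $\mathcal{Fm}^+$ be the algebra on the set of all formulas with the operations $\varphi+\psi=\varphi\lor\psi$, $-\varphi=\neg\varphi$, $c_i\varphi=\exists v_i\varphi$ (cylindrifications), the constants $d_{ij}$, namely the formulas $v_i=v_j$ (diagonal constants), and the unary operations $p_{ij}$ (transpositions), where $p_{ij}\varphi$ is obtained from $\varphi$ by interchanging all occurrences, free or bound, of $v_i$ and $v_j$ ($i,j<\alpha$). Let $\varphi\equiv\psi$ mean that $\varphi\leftrightarrow\psi$ is valid; this is a congruence of $\mathcal{Fm}^+$. An equational axiom system for the equations true in $\mathcal{Fm}^+/{\equiv}$ is a set of equations in the language $+,-,c_i,d_{ij},p_{ij}$ over the algebraic variables $x_0,x_1,x_2,\dots$, all true in $\mathcal{Fm}^+/{\equiv}$, from which every equation true in $\mathcal{Fm}^+/{\equiv}$ is derivable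 in equational logic. Then every equational axiom system for the equations true in $\mathcal{Fm}^+/{\equiv}$ contains, for each natural number $n$, an equation in which at least $n$ distinct algebraic variables occur together with at least one transposition $p_{ij}$ with $i\ne j$, at least one cylindrification $c_m$ and at least one diagonal constant $d_{kl}$ with $k\ne l$. -/

import Mathlib

universe u v

namespace PolyLogic

/-! ## Algebras of polyadic type, terms, equations and equational derivability -/

/-- Algebras of polyadic type: a set `A` with operations `+`, `-`, `c_i`, `d_ij`, `p_ij`
for `i, j < α` (no laws: this is just the similarity type). -/
structure PolyAlg (α : ℕ) (A : Type v) where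
  add : A → A → A
  neg : A → A
  cyl : Fin α → A → A
  diag : Fin α → Fin α → A
  transp : Fin α → Fin α → A → A

/-- Terms of polyadic type over the algebraic variables `x_0, x_1, x_2, …`. -/
inductive PTerm (α : ℕ) : Type
  | var (k : ℕ) : PTerm α
  | add (s t : PTerm α) : PTerm α
  | neg (t : PTerm α) : PTerm α
  | cyl (i : Fin α) (t : PTerm α) : PTerm α
  | diag (i j : Fin α) : PTerm α
  | transp (i j : Fin α) (t : PTerm α) : PTerm α

namespace PTerm

variable {α : ℕ}

/-- The value of a term in an algebra under an evaluation of the algebraic variables. -/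
def eval {A : Type v} (𝒜 : PolyAlg α A) (k : ℕ → A) : PTerm α → A
  | var m => k m
  | add s t => 𝒜.add (s.eval 𝒜 k) (t.eval 𝒜 k)
  | neg t => 𝒜.neg (t.eval 𝒜 k)
  | cyl i t => 𝒜.cyl i (t.eval 𝒜 k)
  | diag i j => 𝒜.diag i j
  | transp i j t => 𝒜.transp i j (t.eval 𝒜 k)

/-- Simultaneous substitution of terms for the algebraic variables. -/
def subst (f : ℕ → PTerm α) : PTerm α → PTerm α
  | var m => f m
  | add s t => add (s.subst f) (t.subst f)
  | neg t => neg (t.subst f)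
  | cyl i t => cyl i (t.subst f)
  | diag i j => diag i j
  | transp i j t => transp i j (t.subst f)

/-- The finite set of algebraic variables occurring in a term. -/
def vars : PTerm α → Finset ℕ
  | var m => {m}
  | add s t => s.vars ∪ t.vars
  | neg t => t.vars
  | cyl _ t => t.vars
  | diag _ _ => ∅
  | transp _ _ t => t.vars

/-- Some cylindrification `c_i` occurs in the term. -/
def HasCyl : PTerm α → Prop
  | var _ => False
  | add s t => s.HasCyl ∨ t.HasCyl
  | neg t => t.HasCyl
  | cyl _ _ => True
  | diag _ _ => False
  | transp _ _ t => t.HasCyl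

/-- Some diagonal constant `d_ij` with `i ≠ j` occurs in the term. -/
def HasDiag : PTerm α → Prop
  | var _ => False
  | add s t => s.HasDiag ∨ t.HasDiag
  | neg t => t.HasDiag
  | cyl _ t => t.HasDiag
  | diag i j => i ≠ j
  | transp _ _ t => t.HasDiag

/-- Some transposition operation `p_ij` with `i ≠ j` occurs in the term. -/
def HasTransp : PTerm α → Prop
  | var _ => False
  | add s t => s.HasTransp ∨ t.HasTransp
  | neg t => t.HasTransp
  | cyl _ t => t.HasTransp
  | diag _ _ => False
  | transp i j t => i ≠ j ∨ t.HasTransp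

end PTerm

/-- Equations between terms of polyadic type. -/
structure Equation (α : ℕ) where
  lhs : PTerm α
  rhs : PTerm α

namespace Equation

variable {α : ℕ}

/-- The algebraic variables occurring in an equation. -/
def vars (e : Equation α) : Finset ℕ := e.lhs.vars ∪ e.rhs.vars

/-- Some cylindrification occurs in the equation. -/
def HasCyl (e : Equation α) : Prop := e.lhs.HasCyl ∨ e.rhs.HasCyl

/-- Some diagonal constant occurs in the equation. -/
def HasDiag (e : Equation α) : Prop := e.lhs.HasDiag ∨ e.rhs.HasDiag

/-- Some transposition operation occurs in the equation. -/
def HasTransp (e : Equation α) : Prop := e.lhs.HasTransp ∨ e.rhs.HasTransp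

/-- The equation is true in the algebra (under all evaluations of the algebraic variables). -/
def TrueIn {A : Type v} (𝒜 : PolyAlg α A) (e : Equation α) : Prop :=
  ∀ k : ℕ → A, e.lhs.eval 𝒜 k = e.rhs.eval 𝒜 k

end Equation

/-- `Derives E s t`: the equation `s = t` is derivable in equational logic from the set of
equations `E` (reflexivity, symmetry, transitivity, replacement, substitution). -/
inductive Derives {α : ℕ} (E : Set (Equation α)) : PTerm α → PTerm α → Prop
  | ax (e : Equation α) (he : e ∈ E) : Derives E e.lhs e.rhs
  | refl (t : PTerm α) : Derives E t t
  | symm {s t : PTerm α} : Derives E s t → Derives E t s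
  | trans {s t r : PTerm α} : Derives E s t → Derives E t r → Derives E s r
  | add {s t s' t' : PTerm α} :
      Derives E s s' → Derives E t t' → Derives E (s.add t) (s'.add t')
  | neg {s t : PTerm α} : Derives E s t → Derives E s.neg t.neg
  | cyl (i : Fin α) {s t : PTerm α} : Derives E s t → Derives E (s.cyl i) (t.cyl i)
  | transp (i j : Fin α) {s t : PTerm α} :
      Derives E s t → Derives E (s.transp i j) (t.transp i j)
  | subst (f : ℕ → PTerm α) {s t : PTerm α} :
      Derives E s t → Derives E (s.subst f) (t.subst f)

/-- `E` is an equational axiom system for the equations true in `𝒜`: all members of `E` are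
true in `𝒜`, and every equation true in `𝒜` is derivable from `E`. -/
def IsEquationalAxiomSystem {α : ℕ} {A : Type v} (𝒜 : PolyAlg α A)
    (E : Set (Equation α)) : Prop :=
  (∀ e ∈ E, e.TrueIn 𝒜) ∧ ∀ e : Equation α, e.TrueIn 𝒜 → Derives E e.lhs e.rhs

/-! ## First-order logic with `α` variables -/

/-- Formulas of first-order logic with equality in the variables `v_i`, `i < α`, with relation
symbols `r : R` of arity `ar r`, and without function or constant symbols. -/
inductive Fm (α : ℕ) {R : Type u} (ar : R → ℕ) : Type u
  | rel (r : R) (x : Fin (ar r) → Fin α) : Fm α ar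
  | eq (i j : Fin α) : Fm α ar
  | or (φ ψ : Fm α ar) : Fm α ar
  | not (φ : Fm α ar) : Fm α ar
  | ex (i : Fin α) (φ : Fm α ar) : Fm α ar

namespace Fm

variable {α : ℕ} {R : Type u} {ar : R → ℕ}

/-- Interchange all occurrences (free, bound and in quantifiers) of `v_i` and `v_j`. -/
def transp (i j : Fin α) : Fm α ar → Fm α ar
  | rel r x => rel r (fun m => Equiv.swap i j (x m))
  | eq k l => eq (Equiv.swap i j k) (Equiv.swap i j l)
  | or φ ψ => or (φ.transp i j) (ψ.transp i j)
  | not φ => not (φ.transp i j)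
  | ex k φ => ex (Equiv.swap i j k) (φ.transp i j)

/-- Tarskian satisfaction of a formula by `s ∈ U^α` in the model `(U, I)`. -/
def Sat {U : Type u} (I : (r : R) → (Fin (ar r) → U) → Prop) : Fm α ar → (Fin α → U) → Prop
  | rel r x, s => I r (fun m => s (x m))
  | eq i j, s => s i = s j
  | or φ ψ, s => φ.Sat I s ∨ ψ.Sat I s
  | not φ, s => ¬ φ.Sat I s
  | ex i φ, s => ∃ a : U, φ.Sat I (Function.update s i a)

/-- `φ ↔ ψ`, as an abbreviation in terms of the connectives `∨` and `¬`. -/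
def iff (φ ψ : Fm α ar) : Fm α ar :=
  not (or (not (or (not φ) ψ)) (not (or (not ψ) φ)))

/-- A formula is valid if it is true in every model (with nonempty universe) under every
evaluation of the variables. -/
def Valid (φ : Fm α ar) : Prop :=
  ∀ (U : Type u) [Nonempty U] (I : (r : R) → (Fin (ar r) → U) → Prop) (s : Fin α → U), φ.Sat I s

/-- Semantic equivalence: `φ ≡ ψ` iff `φ ↔ ψ` is valid. -/
def Equivalent (φ ψ : Fm α ar) : Prop := (φ.iff ψ).Valid

theorem equivalent_iff {φ ψ : Fm α ar} :
    φ.Equivalent ψ ↔ ∀ (U : Type u) [Nonempty U] (I : (r : R) → (Fin (ar r) → U) → Prop)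
      (s : Fin α → U), φ.Sat I s ↔ ψ.Sat I s := by
  unfold Equivalent Valid
  refine forall_congr' fun U => forall_congr' fun _ => forall_congr' fun I =>
    forall_congr' fun s => ?_
  simp only [iff, Sat]
  tauto

theorem sat_transp {U : Type u} (I : (r : R) → (Fin (ar r) → U) → Prop) (i j : Fin α)
    (φ : Fm α ar) : ∀ s : Fin α → U,
      (φ.transp i j).Sat I s ↔ φ.Sat I (fun m => s (Equiv.swap i j m)) := by
  induction φ with
  | rel r x => intro s; rfl
  | eq k l => intro s; rfl
  | or φ ψ h1 h2 => intro s; simp only [transp, Sat, h1, h2]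
  | not φ h => intro s; simp only [transp, Sat, h]
  | ex k φ h =>
    intro s
    simp only [transp, Sat, h]
    refine exists_congr fun a => ?_
    have : (fun m => Function.update s (Equiv.swap i j k) a (Equiv.swap i j m)) =
        Function.update (fun m => s (Equiv.swap i j m)) k a := by
      funext m
      by_cases hm : m = k
      · subst hm; simp
      · simp [hm]
    rw [this]

/-- Semantic equivalence as a setoid on the set of formulas. -/
def equivalence (α : ℕ) {R : Type u} (ar : R → ℕ) : Setoid (Fm α ar) where
  r := Equivalent
  iseqv :=
    { refl := fun _ => equivalent_iff.2 fun _ _ _ _ => Iff.rfl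
      symm := fun h => equivalent_iff.2 fun U _ I s => (equivalent_iff.1 h U I s).symm
      trans := fun h h' => equivalent_iff.2 fun U _ I s =>
        (equivalent_iff.1 h U I s).trans (equivalent_iff.1 h' U I s) }

/-- The algebra of formulas with the transposition functions. -/
def formulaAlgebra (α : ℕ) {R : Type u} (ar : R → ℕ) : PolyAlg α (Fm α ar) where
  add := or
  neg := not
  cyl := ex
  diag := eq
  transp := transp

/-- The tautological formula algebra: the quotient of the algebra of formulas with the
transposition functions by semantic equivalence. -/
def tautologicalAlgebra (α : ℕ) {R : Type u} (ar : R → ℕ) :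
    PolyAlg α (Quotient (equivalence α ar)) where
  add := Quotient.map₂ (formulaAlgebra α ar).add fun _ _ h _ _ h' =>
    equivalent_iff.2 fun U _ I s =>
      or_congr (equivalent_iff.1 h U I s) (equivalent_iff.1 h' U I s)
  neg := Quotient.map (formulaAlgebra α ar).neg fun _ _ h =>
    equivalent_iff.2 fun U _ I s => not_congr (equivalent_iff.1 h U I s)
  cyl i := Quotient.map ((formulaAlgebra α ar).cyl i) fun _ _ h =>
    equivalent_iff.2 fun U _ I _ => exists_congr fun _ => equivalent_iff.1 h U I _
  diag i j := Quotient.mk _ ((formulaAlgebra α ar).diag i j)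
  transp i j := Quotient.map ((formulaAlgebra α ar).transp i j) fun φ ψ h =>
    equivalent_iff.2 fun U _ I s =>
      (sat_transp I i j φ s).trans ((equivalent_iff.1 h U I _).trans (sat_transp I i j ψ s).symm)

end Fm

end PolyLogic

/-! The method is splitting. For every `m` there is an algebra in which some true equation, the
parity equation, fails, although every true equation lacking one kind of operation, or having few
variables compared with `m`, holds in it. A set of true equations of only these forms is therefore
sound there and cannot derive the parity equation.

The algebra consists of sets of tagged sequences over a base with `2 * m + 1` vertices. The only
sequences on which the tag counts are those with two vertices, distinct auxiliary points elsewhere;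
each is thereby split into `2 * m` pieces, which cylindrifications cannot tell apart. To represent
the algebra by genuine relations, one must replace tags by a colouring of the sequences that shows
every colour on every line. Transpositions require the colouring to be symmetric, and diagonals
forbid replacing points by several copies. With all operations this would colour the edges of the
complete graph on `2 * m + 1` vertices with `2 * m` colours, each occurring once at every vertex;
then each colour is a perfect matching on an odd set, which is impossible. The parity equation
expresses this (`parityEquation_trueInSets`, `Pt.parityEquation_fails`).

Each restriction on an equation removes the obstruction. Without cylindrifications a constant tag
suffices; without diagonals, copies of the points carry the colours; without transpositions, the
oriented difference of two vertices is a colour. With few variables many tags are indistinguishable,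
so that `m` colours suffice, and the cyclic distance is a symmetric colouring with every colour at
every vertex. -/

namespace PolyLogic

/-! ### Tagged set algebras and soundness of equational logic -/

open Function

/-- The algebra of all sets of pairs `(s, a)`, with `s ∈ U^α` and a tag `a ∈ I`. The
cylindrifications ignore the tags. For `I = PUnit` this is the full set algebra over `U`. -/
def tagAlg (α : ℕ) (U : Type u) (I : Type v) : PolyAlg α ((Fin α → U) → I → Prop) where
  add Y Z := fun s a => Y s a ∨ Z s a
  neg Y := fun s a => ¬ Y s a
  cyl i Y := fun s _ => ∃ u b, Y (update s i u) b
  diag i j := fun s _ => s i = s j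
  transp i j Y := fun s a => Y (fun l => s (Equiv.swap i j l)) a

namespace PTerm

variable {α : ℕ} {U : Type u} {I : Type v}

theorem eval_subst {A : Type v} (𝒜 : PolyAlg α A) (k : ℕ → A) (f : ℕ → PTerm α) (t : PTerm α) :
    (t.subst f).eval 𝒜 k = t.eval 𝒜 (fun m => (f m).eval 𝒜 k) := by
  induction t <;> simp_all [subst, eval]

/-- A predicate on elements of an algebra that is preserved by all operations. -/
structure Closed {A : Type v} (𝒜 : PolyAlg α A) (S : A → Prop) : Prop where
  add : ∀ {x y}, S x → S y → S (𝒜.add x y)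
  neg : ∀ {x}, S x → S (𝒜.neg x)
  cyl : ∀ i {x}, S x → S (𝒜.cyl i x)
  diag : ∀ i j, S (𝒜.diag i j)
  transp : ∀ i j {x}, S x → S (𝒜.transp i j x)

theorem Closed.eval {A : Type v} {𝒜 : PolyAlg α A} {S : A → Prop} (h : Closed 𝒜 S)
    {k : ℕ → A} (t : PTerm α) (hk : ∀ m ∈ t.vars, S (k m)) : S (t.eval 𝒜 k) := by
  induction t with
  | var m => exact hk m (by simp [vars])
  | add s t hs ht =>
    exact h.add (hs fun m hm => hk m (by simp [vars, hm])) (ht fun m hm => hk m (by simp [vars, hm]))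
  | neg t ht => exact h.neg (ht hk)
  | cyl i t ht => exact h.cyl i (ht hk)
  | diag i j => exact h.diag i j
  | transp i j t ht => exact h.transp i j (ht hk)

end PTerm

open PTerm in
/-- Equational logic is sound for the subalgebra given by a closed predicate. -/
theorem Derives.sound {α : ℕ} {A : Type v} {𝒜 : PolyAlg α A} {S : A → Prop} (hS : Closed 𝒜 S)
    {E : Set (Equation α)}
    (hE : ∀ e ∈ E, ∀ k : ℕ → A, (∀ m, S (k m)) → e.lhs.eval 𝒜 k = e.rhs.eval 𝒜 k)
    {s t : PTerm α} (h : Derives E s t) :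
    ∀ k : ℕ → A, (∀ m, S (k m)) → s.eval 𝒜 k = t.eval 𝒜 k := by
  induction h with
  | ax e he => exact hE e he
  | refl t => exact fun _ _ => rfl
  | symm _ ih => exact fun k hk => (ih k hk).symm
  | trans _ _ ih ih' => exact fun k hk => (ih k hk).trans (ih' k hk)
  | add _ _ ih ih' => intro k hk; simp only [PTerm.eval, ih k hk, ih' k hk]
  | neg _ ih => intro k hk; simp only [PTerm.eval, ih k hk]
  | cyl i _ ih => intro k hk; simp only [PTerm.eval, ih k hk]
  | transp i j _ ih => intro k hk; simp only [PTerm.eval, ih k hk]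
  | subst f _ ih =>
    intro k hk
    simp only [eval_subst]
    exact ih _ fun m => hS.eval _ fun _ _ => hk _

/-- An equation that is true in the full set algebra over every nonempty `U`. -/
def Equation.TrueInSets {α : ℕ} (e : Equation α) : Prop :=
  ∀ (U : Type u) [Nonempty U], e.TrueIn (tagAlg α U PUnit.{u + 1})

/-! ### Truth in the formula algebra and truth in all full set algebras -/

namespace Fm

variable {α : ℕ} {R : Type u} {ar : R → ℕ}

/-- In a fixed model, a formula and the set of sequences satisfying it are built up by the same
operations; terms can thus be evaluated on either side. -/
theorem sat_iff_of_eval_eq {U : Type u} [Nonempty U] (I : (r : R) → (Fin (ar r) → U) → Prop)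
    (φ : ℕ → Fm α ar) (t : PTerm α) :
    ∃ ψ : Fm α ar, t.eval (tautologicalAlgebra α ar) (fun m => Quotient.mk _ (φ m))
        = Quotient.mk _ ψ ∧
      ∀ s, ψ.Sat I s ↔ t.eval (tagAlg α U PUnit.{u + 1}) (fun m s _ => (φ m).Sat I s) s ⟨⟩ := by
  induction t with
  | var m => exact ⟨φ m, rfl, fun s => Iff.rfl⟩
  | add s t hs ht =>
    obtain ⟨ψ, h, h'⟩ := hs
    obtain ⟨χ, g, g'⟩ := ht
    refine ⟨ψ.or χ, ?_, fun s => ?_⟩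
    · simp only [PTerm.eval, h, g]; rfl
    · exact or_congr (h' s) (g' s)
  | neg t ht =>
    obtain ⟨ψ, h, h'⟩ := ht
    refine ⟨ψ.not, ?_, fun s => ?_⟩
    · simp only [PTerm.eval, h]; rfl
    · exact not_congr (h' s)
  | cyl i t ht =>
    obtain ⟨ψ, h, h'⟩ := ht
    refine ⟨ψ.ex i, ?_, fun s => ?_⟩
    · simp only [PTerm.eval, h]; rfl
    · exact exists_congr fun u => (h' _).trans ⟨fun h => ⟨_, h⟩, fun ⟨_, h⟩ => h⟩
  | diag i j => exact ⟨eq i j, rfl, fun s => Iff.rfl⟩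
  | transp i j t ht =>
    obtain ⟨ψ, h, h'⟩ := ht
    refine ⟨ψ.transp i j, ?_, fun s => ?_⟩
    · simp only [PTerm.eval, h]; rfl
    · exact (sat_transp I i j ψ s).trans (h' _)

theorem trueIn_tautologicalAlgebra_of_trueInSets {e : Equation α}
    (he : Equation.TrueInSets.{u} e) : e.TrueIn (tautologicalAlgebra α ar) := by
  intro k
  obtain ⟨φ, rfl⟩ : ∃ φ : ℕ → Fm α ar, k = fun m => Quotient.mk _ (φ m) :=
    ⟨fun m => (k m).out, funext fun m => (Quotient.out_eq _).symm⟩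
  -- The one-point model only provides representatives of the two classes. Those obtained later for
  -- an arbitrary model lie in the same classes, hence are equivalent to these.
  obtain ⟨ψ, h, -⟩ := sat_iff_of_eval_eq (U := PUnit) (fun _ _ => True) φ e.lhs
  obtain ⟨χ, g, -⟩ := sat_iff_of_eval_eq (U := PUnit) (fun _ _ => True) φ e.rhs
  rw [h, g]
  refine Quotient.sound (equivalent_iff.2 fun U _ I s => ?_)
  obtain ⟨ψ', h1, h2⟩ := sat_iff_of_eval_eq I φ e.lhs
  obtain ⟨χ', g1, g2⟩ := sat_iff_of_eval_eq I φ e.rhs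
  have a := equivalent_iff.1 (Quotient.exact (h.symm.trans h1)) U I s
  have b := equivalent_iff.1 (Quotient.exact (g.symm.trans g1)) U I s
  rw [a, b, h2, g2, he U]

/-- Distinct `α`-place relation symbols can be interpreted independently, so any evaluation of the
algebraic variables by sets of sequences comes from a model. -/
theorem trueInSets_of_trueIn_tautologicalAlgebra (hinf : {r : R | ar r = α}.Infinite)
    {e : Equation α} (he : e.TrueIn (tautologicalAlgebra α ar)) :
    Equation.TrueInSets.{u} e := by
  intro U _ k
  classical
  have hr := fun m => (hinf.natEmbedding _ m).2
  let r : ℕ → R := fun m => (hinf.natEmbedding _ m).1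
  have hinj : Injective r := fun a b h => (hinf.natEmbedding _).injective (Subtype.ext h)
  have hr : ∀ m, ar (r m) = α := hr
  let φ : ℕ → Fm α ar := fun m => rel (r m) (Fin.cast (hr m))
  let I : (r : R) → (Fin (ar r) → U) → Prop := fun r' x =>
    ∃ m, ∃ h : r' = r m, k m (fun l => x (Fin.cast (by rw [h, hr]) l)) ⟨⟩
  have hk : (fun m s (_ : PUnit) => (φ m).Sat I s) = k := by
    funext m s x
    refine propext ⟨?_, fun h => ⟨m, rfl, h⟩⟩
    rintro ⟨m', h, h'⟩
    obtain rfl := hinj h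
    exact h'
  obtain ⟨ψ, h1, h2⟩ := sat_iff_of_eval_eq I φ e.lhs
  obtain ⟨χ, g1, g2⟩ := sat_iff_of_eval_eq I φ e.rhs
  have := equivalent_iff.1 (Quotient.exact (h1.symm.trans ((he _).trans g1))) U I
  funext s x
  rw [← hk]
  exact propext ((h2 s).symm.trans ((this s).trans (g2 s)))

end Fm

/-! ### Representing tagged sets by sets of sequences -/

section Representation

variable {α : ℕ} {U : Type v} {U' : Type u} {I : Type v}

/-- Every line of `U'^α` through a point over a tagged point of `Y` meets the preimage of `Y`
under `s ↦ (π ∘ s, χ s)`, for all `Y` satisfying `S`. -/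
def Fits (π : U' → U) (χ : (Fin α → U') → I) (S : ((Fin α → U) → I → Prop) → Prop) : Prop :=
  ∀ Y, S Y → ∀ (s : Fin α → U') (i : Fin α) (b : I), Y (π ∘ s) b →
    ∃ u, Y (π ∘ update s i u) (χ (update s i u))

/-- The pullback along `s ↦ (π ∘ s, χ s)` always preserves the Boolean operations. Each of the last
three hypotheses is what one further kind of operation needs, and it is required only if that kind
occurs. -/
theorem eval_pullback {S : ((Fin α → U) → I → Prop) → Prop} (hS : PTerm.Closed (tagAlg α U I) S)
    {π : U' → U} (hπ : Surjective π) {χ : (Fin α → U') → I} {k : ℕ → (Fin α → U) → I → Prop}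
    (t : PTerm α) (hk : ∀ m ∈ t.vars, S (k m)) (hc : t.HasCyl → Fits π χ S)
    (hd : t.HasDiag → Injective π)
    (hp : t.HasTransp → ∀ i j s, χ (fun l => s (Equiv.swap i j l)) = χ s) (s : Fin α → U') :
    t.eval (tagAlg α U' PUnit.{u + 1}) (fun m s _ => k m (π ∘ s) (χ s)) s ⟨⟩ ↔
      t.eval (tagAlg α U I) k (π ∘ s) (χ s) := by
  induction t generalizing s with
  | var m => exact Iff.rfl
  | add t₁ t₂ h₁ h₂ =>
    exact or_congr
      (h₁ (fun m hm => hk m (by simp [PTerm.vars, hm])) (fun h => hc (Or.inl h))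
        (fun h => hd (Or.inl h)) (fun h => hp (Or.inl h)) s)
      (h₂ (fun m hm => hk m (by simp [PTerm.vars, hm])) (fun h => hc (Or.inr h))
        (fun h => hd (Or.inr h)) (fun h => hp (Or.inr h)) s)
  | neg t ht => exact not_congr (ht hk hc hd hp s)
  | cyl i t ht =>
    have ht := ht hk (fun _ => hc trivial) hd hp
    constructor
    · rintro ⟨u, ⟨⟩, h⟩
      have := (ht _).1 h
      rw [comp_update] at this
      exact ⟨_, _, this⟩
    · rintro ⟨u, b, h⟩
      obtain ⟨u, rfl⟩ := hπ u
      rw [← comp_update] at h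
      obtain ⟨u', h'⟩ := hc trivial _ (hS.eval t hk) _ i b h
      rw [update_idem] at h'
      exact ⟨u', ⟨⟩, (ht _).2 h'⟩
  | diag i j =>
    change s i = s j ↔ π (s i) = π (s j)
    by_cases hij : i = j
    · simp [hij]
    · exact (hd hij).eq_iff.symm
  | transp i j t ht =>
    have ht := ht hk hc hd fun h => hp (Or.inr h)
    refine (ht _).trans ?_
    change t.eval (tagAlg α U I) k (π ∘ fun l => s (Equiv.swap i j l)) _ ↔
      t.eval (tagAlg α U I) k (π ∘ fun l => s (Equiv.swap i j l)) _
    by_cases hij : i = j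
    · simp [hij]
    · rw [hp (Or.inl hij)]

variable {S : ((Fin α → U) → I → Prop) → Prop} {e : Equation α}
  {k : ℕ → (Fin α → U) → I → Prop}

theorem eval_iff_of_trueInSets (hS : PTerm.Closed (tagAlg α U I) S)
    (he : Equation.TrueInSets.{u} e) [Nonempty U']
    {π : U' → U} (hπ : Surjective π) {χ : (Fin α → U') → I}
    (hk : ∀ m ∈ e.vars, S (k m)) (hc : e.HasCyl → Fits π χ S)
    (hd : e.HasDiag → Injective π)
    (hp : e.HasTransp → ∀ i j s, χ (fun l => s (Equiv.swap i j l)) = χ s) (s : Fin α → U') :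
    e.lhs.eval (tagAlg α U I) k (π ∘ s) (χ s) ↔ e.rhs.eval (tagAlg α U I) k (π ∘ s) (χ s) := by
  rw [← eval_pullback hS hπ e.lhs (fun m hm => hk m (by simp [Equation.vars, hm]))
      (fun h => hc (Or.inl h)) (fun h => hd (Or.inl h)) (fun h => hp (Or.inl h)),
    ← eval_pullback hS hπ e.rhs (fun m hm => hk m (by simp [Equation.vars, hm]))
      (fun h => hc (Or.inr h)) (fun h => hd (Or.inr h)) (fun h => hp (Or.inr h)), he U']

/-- `χ` need not attain every tag over every sequence, so equality of the pullbacks must be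
transferred back. By `Fits`, a nonempty difference of two members of `S` has a nonempty pullback. -/
theorem eval_eq_of_fits (hS : PTerm.Closed (tagAlg α U I) S)
    (he : Equation.TrueInSets.{u} e) [Nonempty U'] (hα : 0 < α)
    {π : U' → U} (hπ : Surjective π) {χ : (Fin α → U') → I}
    (hk : ∀ m ∈ e.vars, S (k m)) (hc : Fits π χ S)
    (hd : e.HasDiag → Injective π)
    (hp : e.HasTransp → ∀ i j s, χ (fun l => s (Equiv.swap i j l)) = χ s) :
    e.lhs.eval (tagAlg α U I) k = e.rhs.eval (tagAlg α U I) k := by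
  have key := eval_iff_of_trueInSets hS he hπ hk (fun _ => hc) hd hp
  have hl : S (e.lhs.eval (tagAlg α U I) k) :=
    hS.eval _ fun m hm => hk m (by simp [Equation.vars, hm])
  have hr : S (e.rhs.eval (tagAlg α U I) k) :=
    hS.eval _ fun m hm => hk m (by simp [Equation.vars, hm])
  have sub : ∀ {Y Z : (Fin α → U) → I → Prop}, S Y → S Z →
      (∀ s, Y (π ∘ s) (χ s) → Z (π ∘ s) (χ s)) → ∀ s a, Y s a → Z s a := by
    intro Y Z hY hZ h s a hs
    by_contra hs'
    obtain ⟨s, rfl⟩ := hπ.comp_left s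
    have := hc _ (hS.neg (hS.add (hS.neg hY) hZ)) s ⟨0, hα⟩ a (by
      rintro (h | h)
      · exact h hs
      · exact hs' h)
    obtain ⟨u, hu⟩ := this
    refine hu ?_
    by_cases h' : Y (π ∘ update s ⟨0, hα⟩ u) (χ (update s ⟨0, hα⟩ u))
    · exact Or.inr (h _ h')
    · exact Or.inl h'
  funext s a
  exact propext ⟨sub hl hr (fun s => (key s).1) s a, sub hr hl (fun s => (key s).2) s a⟩

/-- Without cylindrifications the tags do not interact, and each constant tag gives a homomorphism
to a full set algebra. -/
theorem eval_eq_of_not_hasCyl (hS : PTerm.Closed (tagAlg α U I) S)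
    (he : Equation.TrueInSets.{u} e) [Nonempty U'] {π : U' → U} (hπ : Bijective π)
    (hk : ∀ m ∈ e.vars, S (k m)) (hc : ¬ e.HasCyl) :
    e.lhs.eval (tagAlg α U I) k = e.rhs.eval (tagAlg α U I) k := by
  funext s a
  obtain ⟨s, rfl⟩ := hπ.2.comp_left s
  exact propext (eval_iff_of_trueInSets hS he hπ.2 (χ := fun _ => a) hk (fun h => (hc h).elim)
    (fun _ => hπ.1) (fun _ _ _ _ => rfl) s)

end Representation

/-! ### The base set, its symmetries and the tame sets -/

theorem exists_perm_apply_eq {ι X : Type*} [Finite ι] {f g : ι → X} (hf : Injective f)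
    (hg : Injective g) : ∃ σ : Equiv.Perm X, ∀ i, σ (f i) = g i := by
  classical
  obtain ⟨n, ⟨e⟩⟩ := Finite.exists_equiv_fin ι
  have h := Equiv.Perm.isMultiplyPretransitive X n
  obtain ⟨σ, hσ⟩ := h.exists_smul_eq (e.symm.toEmbedding.trans ⟨f, hf⟩)
    (e.symm.toEmbedding.trans ⟨g, hg⟩)
  refine ⟨σ, fun i => ?_⟩
  simpa using DFunLike.congr_fun hσ (e i)

/-- The points of the base: vertices, auxiliary points, and permutations of the vertices. -/
inductive Pt (m : ℕ) : Type
  | vertex (x : ZMod (2 * m + 1)) : Pt m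
  | aux (n : ℕ) : Pt m
  | perm (g : Equiv.Perm (ZMod (2 * m + 1))) : Pt m

namespace Pt

variable {m α : ℕ}

def IsVertex : Pt m → Prop
  | vertex _ => True
  | _ => False

def IsPerm : Pt m → Prop
  | perm _ => True
  | _ => False

theorem IsVertex.exists_eq : ∀ {p : Pt m}, p.IsVertex → ∃ x, p = vertex x
  | vertex x, _ => ⟨x, rfl⟩

theorem exists_eq_aux : ∀ {p : Pt m}, ¬ p.IsVertex → ¬ p.IsPerm → ∃ n, p = aux n
  | vertex _, h, _ => (h trivial).elim
  | aux n, _, _ => ⟨n, rfl⟩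
  | perm _, _, h => (h trivial).elim

/-- The action of permutations of the vertices and of the auxiliary points. -/
def act (g : Equiv.Perm (ZMod (2 * m + 1))) (h : Equiv.Perm ℕ) : Pt m → Pt m
  | vertex x => vertex (g x)
  | aux n => aux (h n)
  | perm f => perm (g * f)

theorem act_act (g g' : Equiv.Perm (ZMod (2 * m + 1))) (h h' : Equiv.Perm ℕ) (p : Pt m) :
    act g h (act g' h' p) = act (g * g') (h * h') p := by
  cases p <;> simp [act, mul_assoc]

theorem act_one (p : Pt m) : act 1 1 p = p := by
  cases p <;> simp [act]

theorem act_injective (g : Equiv.Perm (ZMod (2 * m + 1))) (h : Equiv.Perm ℕ) :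
    Injective (act g h) := fun p q e => by
  have := congrArg (act g⁻¹ h⁻¹) e
  simpa [act_act, act_one] using this

theorem act_surjective (g : Equiv.Perm (ZMod (2 * m + 1))) (h : Equiv.Perm ℕ) :
    Surjective (act g h) := fun p => ⟨act g⁻¹ h⁻¹ p, by simp [act_act, act_one]⟩

@[simp] theorem isVertex_act (g : Equiv.Perm (ZMod (2 * m + 1))) (h : Equiv.Perm ℕ) (p : Pt m) :
    (act g h p).IsVertex ↔ p.IsVertex := by cases p <;> rfl

@[simp] theorem isPerm_act (g : Equiv.Perm (ZMod (2 * m + 1))) (h : Equiv.Perm ℕ) (p : Pt m) :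
    (act g h p).IsPerm ↔ p.IsPerm := by cases p <;> rfl

/-- Injective sequences of two vertices and some auxiliary points. -/
def Splittable (s : Fin α → Pt m) : Prop :=
  Injective s ∧ (∀ l, ¬ (s l).IsPerm) ∧ ∃ i j, i ≠ j ∧ ∀ l, (s l).IsVertex ↔ l = i ∨ l = j

theorem splittable_act (g : Equiv.Perm (ZMod (2 * m + 1))) (h : Equiv.Perm ℕ)
    (s : Fin α → Pt m) : Splittable (act g h ∘ s) ↔ Splittable s := by
  simp only [Splittable, (act_injective g h).of_comp_iff, comp_apply, isPerm_act, isVertex_act]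

theorem Splittable.swap {s : Fin α → Pt m} (hs : Splittable s) (i j : Fin α) :
    Splittable (fun l => s (Equiv.swap i j l)) := by
  obtain ⟨h1, h2, i', j', hij, h3⟩ := hs
  refine ⟨h1.comp (Equiv.swap i j).injective, fun l => h2 _, Equiv.swap i j i',
    Equiv.swap i j j', fun h => hij ((Equiv.swap i j).injective h), fun l => ?_⟩
  rw [h3, ← Equiv.symm_apply_eq, ← Equiv.symm_apply_eq, Equiv.symm_swap]

theorem splittable_swap {s : Fin α → Pt m} (i j : Fin α) :
    Splittable (fun l => s (Equiv.swap i j l)) ↔ Splittable s :=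
  ⟨fun h => by simpa using h.swap i j, fun h => h.swap i j⟩

theorem Splittable.update {s : Fin α → Pt m} (hs : Splittable s) {i : Fin α} {p : Pt m}
    (hp : ∀ l, l ≠ i → s l ≠ p) (hv : p.IsVertex ↔ (s i).IsVertex) (ht : ¬ p.IsPerm) :
    Splittable (update s i p) ∧ ∀ l, (update s i p l).IsVertex ↔ (s l).IsVertex := by
  have hvv : ∀ l, (Function.update s i p l).IsVertex ↔ (s l).IsVertex := by
    intro l
    by_cases hl : l = i
    · subst hl; simpa using hv
    · simp [hl]
  obtain ⟨h1, h2, h3⟩ := hs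
  refine ⟨⟨fun a b hab => ?_, fun l => ?_, by simpa only [hvv] using h3⟩, hvv⟩
  · by_cases ha : a = i <;> by_cases hb : b = i
    · rw [ha, hb]
    · subst ha
      simp only [update_self, update_of_ne hb] at hab
      exact (hp b hb hab.symm).elim
    · subst hb
      simp only [update_self, update_of_ne ha] at hab
      exact (hp a ha hab).elim
    · simp only [update_of_ne hb, update_of_ne ha] at hab
      exact h1 hab
  · by_cases hl : l = i
    · subst hl; simpa using ht
    · simpa [hl] using h2 l

/-- The vertices and the auxiliary points are permuted independently and arbitrarily, so the orbit
of a splittable sequence depends only on the positions of its two vertices. -/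
theorem Splittable.exists_act_eq {s s' : Fin α → Pt m} (hs : Splittable s) (hs' : Splittable s')
    (h : ∀ l, (s' l).IsVertex ↔ (s l).IsVertex) : ∃ g h, act g h ∘ s = s' := by
  choose f hf using fun l : {l // (s l).IsVertex} => l.2.exists_eq
  choose f' hf' using fun l : {l // (s l).IsVertex} => ((h l).2 l.2).exists_eq
  choose d hd using fun l : {l // ¬ (s l).IsVertex} => exists_eq_aux l.2 (hs.2.1 l)
  choose d' hd' using fun l : {l // ¬ (s l).IsVertex} =>
    exists_eq_aux (fun hl => l.2 ((h l).1 hl)) (hs'.2.1 l)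
  obtain ⟨g, hg⟩ := exists_perm_apply_eq (f := f) (g := f')
    (fun a b hab => Subtype.ext (hs.1 (by rw [hf, hf, hab])))
    (fun a b hab => Subtype.ext (hs'.1 (by rw [hf', hf', hab])))
  obtain ⟨g', hg'⟩ := exists_perm_apply_eq (f := d) (g := d')
    (fun a b hab => Subtype.ext (hs.1 (by rw [hd, hd, hab])))
    (fun a b hab => Subtype.ext (hs'.1 (by rw [hd', hd', hab])))
  refine ⟨g, g', funext fun l => ?_⟩
  by_cases hl : (s l).IsVertex
  · have := hf ⟨l, hl⟩
    have h' := hf' ⟨l, hl⟩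
    simp only at this h'
    rw [comp_apply, this, h', act, hg]
  · have := hd ⟨l, hl⟩
    have h' := hd' ⟨l, hl⟩
    simp only at this h'
    rw [comp_apply, this, h', act, hg']

/-- Sets of tagged sequences that are invariant under the action, where the tag matters only for
splittable sequences, and only up to `r`. -/
structure Tame {I : Type} (r : I → I → Prop) (Y : (Fin α → Pt m) → I → Prop) : Prop where
  act : ∀ g h s a, Y (act g h ∘ s) a ↔ Y s a
  tag : ∀ s, ¬ Splittable s → ∀ a b, Y s a ↔ Y s b
  rel : ∀ s a b, r a b → (Y s a ↔ Y s b)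

theorem closed_tame {I : Type} (r : I → I → Prop) :
    PTerm.Closed (tagAlg α (Pt m) I) (Tame r) where
  add hY hZ := ⟨fun g h s a => or_congr (hY.act g h s a) (hZ.act g h s a),
    fun s hs a b => or_congr (hY.tag s hs a b) (hZ.tag s hs a b),
    fun s a b hab => or_congr (hY.rel s a b hab) (hZ.rel s a b hab)⟩
  neg hY := ⟨fun g h s a => not_congr (hY.act g h s a),
    fun s hs a b => not_congr (hY.tag s hs a b),
    fun s a b hab => not_congr (hY.rel s a b hab)⟩
  cyl i {Y} hY := by
    refine ⟨fun g h s a => ?_, fun _ _ _ _ => Iff.rfl, fun _ _ _ _ => Iff.rfl⟩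
    constructor
    · rintro ⟨u, b, hu⟩
      obtain ⟨u, rfl⟩ := act_surjective g h u
      rw [← comp_update, hY.act] at hu
      exact ⟨u, b, hu⟩
    · rintro ⟨u, b, hu⟩
      rw [← hY.act g h, comp_update] at hu
      exact ⟨_, b, hu⟩
  diag i j := ⟨fun g h s a => (act_injective g h).eq_iff, fun _ _ _ _ => Iff.rfl,
    fun _ _ _ _ => Iff.rfl⟩
  transp i j {Y} hY := ⟨fun g h s a => hY.act g h _ a,
    fun s hs a b => hY.tag _ (by rwa [splittable_swap]) a b, fun s a b hab => hY.rel _ a b hab⟩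

/-- A splittable sequence can be moved along the line to one in the same orbit having the wanted tag
up to `r`, and tame sets do not notice the move. For other sequences the tag is irrelevant and
nothing has to be moved. -/
theorem fits_of_coloring {I : Type} {r : I → I → Prop} {U' : Type u} {π : U' → Pt m}
    {χ : (Fin α → U') → I}
    (h : ∀ s, Splittable (π ∘ s) → ∀ i a, ∃ u, Splittable (π ∘ update s i u) ∧
      (∀ l, (π (update s i u l)).IsVertex ↔ (π (s l)).IsVertex) ∧ r a (χ (update s i u))) :
    Fits π χ (Tame r) := by
  intro Y hY s i b hs
  by_cases hsp : Splittable (π ∘ s)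
  · obtain ⟨u, h1, h2, h3⟩ := h s hsp i b
    obtain ⟨g, g', hg⟩ := hsp.exists_act_eq h1 h2
    refine ⟨u, ?_⟩
    rw [← hY.rel _ _ _ h3, ← hg, hY.act]
    exact hs
  · refine ⟨s i, ?_⟩
    rw [update_eq_self]
    exact (hY.tag _ hsp _ _).1 hs

/-! ### Colourings with all colours on every line -/

/-- The weight of an auxiliary point modulo `M`. -/
def weight (M : ℕ) : Pt m → ZMod M
  | aux n => n
  | _ => 0

/-- A function of two vertices, extended by zero to all points. -/
def pairWeight {M : ℕ} (f : ZMod (2 * m + 1) → ZMod (2 * m + 1) → ZMod M) : Pt m → Pt m → ZMod M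
  | vertex x, vertex y => f x y
  | _, _ => 0

theorem pairWeight_left {M : ℕ} (f : ZMod (2 * m + 1) → ZMod (2 * m + 1) → ZMod M) {p q : Pt m}
    (h : ¬ p.IsVertex) : pairWeight f p q = 0 := by
  cases p <;> first | rfl | exact (h trivial).elim

theorem pairWeight_right {M : ℕ} (f : ZMod (2 * m + 1) → ZMod (2 * m + 1) → ZMod M) {p q : Pt m}
    (h : ¬ q.IsVertex) : pairWeight f p q = 0 := by
  cases q <;> cases p <;> first | rfl | exact (h trivial).elim

/-- The colour of a sequence of points. -/
def color {M : ℕ} (E : Fin α → Fin α → ZMod (2 * m + 1) → ZMod (2 * m + 1) → ZMod M)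
    (s : Fin α → Pt m) : ZMod M :=
  ∑ i, ∑ j, pairWeight (E i j) (s i) (s j) + ∑ l, weight M (s l)

theorem color_swap {M : ℕ} (E : ZMod (2 * m + 1) → ZMod (2 * m + 1) → ZMod M) (i j : Fin α)
    (s : Fin α → Pt m) :
    color (fun _ _ => E) (fun l => s (Equiv.swap i j l)) = color (fun _ _ => E) s := by
  unfold color
  congr 1
  · rw [Equiv.sum_comp (Equiv.swap i j) fun a =>
      ∑ b, pairWeight E (s a) (s (Equiv.swap i j b))]
    exact Finset.sum_congr rfl fun a _ =>
      Equiv.sum_comp (Equiv.swap i j) fun b => pairWeight E (s a) (s b)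
  · exact Equiv.sum_comp (Equiv.swap i j) fun a => weight M (s a)

theorem sum_pairWeight {M : ℕ}
    {E : Fin α → Fin α → ZMod (2 * m + 1) → ZMod (2 * m + 1) → ZMod M}
    (hE : ∀ i x, E i i x x = 0) {s : Fin α → Pt m} {i j : Fin α} (hij : i ≠ j)
    (hs : ∀ l, (s l).IsVertex ↔ l = i ∨ l = j) {x y : ZMod (2 * m + 1)} (hx : s i = vertex x)
    (hy : s j = vertex y) :
    ∑ a, ∑ b, pairWeight (E a b) (s a) (s b) = E i j x y + E j i y x := by
  have hz : ∀ a b, a ≠ i ∧ a ≠ j ∨ b ≠ i ∧ b ≠ j → pairWeight (E a b) (s a) (s b) = 0 := by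
    rintro a b (h | h)
    · exact pairWeight_left _ fun h' => by
        rcases (hs _).1 h' with h' | h'
        exacts [h.1 h', h.2 h']
    · exact pairWeight_right _ fun h' => by
        rcases (hs _).1 h' with h' | h'
        exacts [h.1 h', h.2 h']
  have h (a : Fin α) : ∑ b, pairWeight (E a b) (s a) (s b) =
      pairWeight (E a i) (s a) (s i) + pairWeight (E a j) (s a) (s j) :=
    Finset.sum_eq_add i j hij (fun b _ hb => hz a b (Or.inr hb)) (by simp) (by simp)
  rw [Finset.sum_eq_add i j hij
    (fun a _ ha => Finset.sum_eq_zero fun b _ => hz a b (Or.inl ha)) (by simp) (by simp), h, h]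
  simp [hx, hy, pairWeight, hE]

/-- On a line that moves a vertex, the edge term alone can be adjusted, which is what `hE'` allows.
On a line that moves an auxiliary point, only the weight changes, and every residue has infinitely
many representatives. -/
theorem exists_color_update {M : ℕ} [NeZero M]
    {E : Fin α → Fin α → ZMod (2 * m + 1) → ZMod (2 * m + 1) → ZMod M}
    (hE : ∀ i x, E i i x x = 0)
    (hE' : ∀ i j, i ≠ j → ∀ y c, ∃ x, x ≠ y ∧ E i j x y + E j i y x = c)
    {s : Fin α → Pt m} (hs : Splittable s) (i : Fin α) (c : ZMod M) :
    ∃ p, Splittable (update s i p) ∧ (∀ l, (update s i p l).IsVertex ↔ (s l).IsVertex) ∧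
      color E (update s i p) = c := by
  have hsum (p : Pt m) : ∑ l, weight M (update s i p l) =
      weight M p + ∑ l ∈ Finset.univ.erase i, weight M (s l) := by
    rw [← Finset.add_sum_erase _ _ (Finset.mem_univ i), update_self]
    congr 1
    exact Finset.sum_congr rfl fun l hl => by rw [update_of_ne (Finset.ne_of_mem_erase hl)]
  set w := ∑ l ∈ Finset.univ.erase i, weight M (s l) with hw
  by_cases hv : (s i).IsVertex
  · obtain ⟨j, hij, hj⟩ : ∃ j, i ≠ j ∧ ∀ l, (s l).IsVertex ↔ l = i ∨ l = j := by
      obtain ⟨i', j', hij, h⟩ := hs.2.2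
      rcases (h i).1 hv with rfl | rfl
      · exact ⟨j', hij, h⟩
      · exact ⟨i', hij.symm, fun l => (h l).trans or_comm⟩
    obtain ⟨y, hy⟩ := ((hj j).2 (Or.inr rfl)).exists_eq
    obtain ⟨x, hxy, hx⟩ := hE' i j hij y (c - w)
    obtain ⟨h1, h2⟩ := hs.update (i := i) (p := vertex x) (fun l hl h => by
      rcases (hj l).1 (by rw [h]; trivial) with rfl | rfl
      · exact hl rfl
      · rw [hy] at h
        cases h
        exact hxy rfl) (iff_of_true trivial hv) id
    refine ⟨vertex x, h1, h2, ?_⟩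
    have h3 := sum_pairWeight hE hij (fun l => (h2 l).trans (hj l)) (x := x) (y := y)
      (by rw [update_self]) (by rw [update_of_ne hij.symm, hy])
    rw [color, h3, hsum, hx]
    simp [weight]
  · set d := ∑ a, ∑ b, pairWeight (E a b) (s a) (s b) with hd
    have hinf : {n : ℕ | (n : ZMod M) = c - d - w}.Infinite := by
      refine Set.infinite_of_injective_forall_mem (f := fun t : ℕ => (c - d - w).val + M * t)
        (fun a b hab => ?_) fun t => ?_
      · have : M * a = M * b := Nat.add_left_cancel hab
        exact Nat.eq_of_mul_eq_mul_left (Nat.pos_of_ne_zero (NeZero.ne M)) this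
      · simp
    have hfin : {n : ℕ | aux n ∈ Set.range s}.Finite :=
      Set.Finite.preimage (fun a _ b _ h => by cases h; rfl) (Set.finite_range s)
    -- A fresh auxiliary point is chosen, to keep the sequence injective.
    obtain ⟨n, hn, hn'⟩ := (hinf.sdiff hfin).nonempty
    obtain ⟨h1, h2⟩ := hs.update (i := i) (p := aux n) (fun l hl h => hn' ⟨l, h⟩)
      (iff_of_false id hv) id
    refine ⟨aux n, h1, h2, ?_⟩
    have h3 : ∑ a, ∑ b, pairWeight (E a b) (update s i (aux n) a) (update s i (aux n) b) = d := by
      refine Finset.sum_congr rfl fun a _ => Finset.sum_congr rfl fun b _ => ?_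
      by_cases ha : a = i
      · subst ha
        rw [pairWeight_left _ hv, pairWeight_left _ (by rw [update_self]; exact id)]
      · by_cases hb : b = i
        · subst hb
          rw [pairWeight_right _ hv, pairWeight_right _ (by rw [update_self]; exact id)]
        · rw [update_of_ne ha, update_of_ne hb]
    rw [color, h3, hsum]
    have : weight M (aux n : Pt m) = c - d - w := hn
    rw [this]
    ring

theorem exists_natCast_eq (M : ℕ) [NeZero M] (c : ZMod M) :
    ∃ n : ℕ, 1 ≤ n ∧ n ≤ M ∧ (n : ZMod M) = c := by
  by_cases hc : c = 0
  · exact ⟨M, NeZero.one_le, le_rfl, by simp [hc]⟩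
  · refine ⟨c.val, Nat.one_le_iff_ne_zero.2 ?_, c.val_lt.le, by simp⟩
    rwa [Ne, ZMod.val_eq_zero]

theorem natCast_ne_zero {n : ℕ} (h1 : 1 ≤ n) (h2 : n ≤ 2 * m) : (n : ZMod (2 * m + 1)) ≠ 0 := by
  rw [Ne, ZMod.natCast_eq_zero_iff]
  exact fun h => by have := Nat.le_of_dvd h1 h; omega

/-- A colouring by `2 * m` colours such that on each line all colours occur. -/
theorem exists_latin_coloring (hm : 1 ≤ m) : ∃ χ : (Fin α → Pt m) → ZMod (2 * m),
    ∀ s, Splittable s → ∀ i c, ∃ p, Splittable (update s i p) ∧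
      (∀ l, (update s i p l).IsVertex ↔ (s l).IsVertex) ∧ χ (update s i p) = c := by
  have : NeZero (2 * m) := ⟨by omega⟩
  -- The order of the coordinates orients the edge. The nonzero differences `1, …, 2 * m` represent
  -- each residue modulo `2 * m` once.
  refine ⟨color fun i j x y => if i < j then ((y - x).val : ZMod (2 * m)) else 0,
    fun s hs => exists_color_update (by simp) (fun i j hij y c => ?_) hs⟩
  obtain ⟨n, h1, h2, rfl⟩ := exists_natCast_eq (2 * m) c
  have hn : ((n : ZMod (2 * m + 1))).val = n := ZMod.val_natCast_of_lt (by omega)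
  have h0 := natCast_ne_zero h1 h2
  rcases lt_or_gt_of_ne hij with h | h
  · exact ⟨y - n, by simpa using h0, by simp [h, h.not_gt, hn]⟩
  · exact ⟨y + n, by simpa using h0, by simp [h, h.not_gt, hn]⟩

/-- A symmetric colouring by `m` colours such that on each line all colours occur. -/
theorem exists_symmetric_coloring (hm : 1 ≤ m) : ∃ χ : (Fin α → Pt m) → ZMod m,
    (∀ i j s, χ (fun l => s (Equiv.swap i j l)) = χ s) ∧
    ∀ s, Splittable s → ∀ i c, ∃ p, Splittable (update s i p) ∧
      (∀ l, (update s i p l).IsVertex ↔ (s l).IsVertex) ∧ χ (update s i p) = c := by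
  have : NeZero m := ⟨by omega⟩
  -- Cyclic distances between distinct vertices are `1, …, m`. Comparing the values of the vertices
  -- rather than the coordinates counts each edge once and keeps the colouring symmetric.
  refine ⟨color fun _ _ x y => if x.val < y.val then ((y - x).valMinAbs.natAbs : ZMod m) else 0,
    color_swap _, fun s hs => exists_color_update (by simp) (fun i j hij y c => ?_) hs⟩
  obtain ⟨n, h1, h2, rfl⟩ := exists_natCast_eq m c
  have h0 := natCast_ne_zero (m := m) h1 (by omega)
  have hn : ((n : ZMod (2 * m + 1))).valMinAbs = n := ZMod.valMinAbs_natCast_of_le_half (by omega)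
  have hne : (y + n) ≠ y := by simpa using h0
  have hsymm : (y - (y + n)).valMinAbs.natAbs = (y + n - y).valMinAbs.natAbs := by
    rw [← ZMod.natAbs_valMinAbs_neg, neg_sub]
  refine ⟨y + n, hne, ?_⟩
  rw [hsymm, add_sub_cancel_left, hn, Int.natAbs_natCast]
  rcases lt_or_gt_of_ne (fun h => hne (ZMod.val_injective _ h)) with h | h
  · simp [h, h.not_gt]
  · simp [h, h.not_gt]

end Pt

/-! ### The parity argument -/

/-- There is no partition of a relation into `2 * m` symmetric and irreflexive relations, all with
the same domain, if this domain has at most `2 * m + 1` elements. -/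
theorem false_of_symmetric_partition {U : Type u} {m : ℕ} {Q : ℕ → U → U → Prop}
    {F : ℕ → U → Prop} (hne : ∃ x y, Q 0 x y) (hm : 1 ≤ m)
    (hdisj : ∀ a < 2 * m, ∀ b < 2 * m, ∀ x y, Q a x y → Q b x y → a = b)
    (hex : ∀ a < 2 * m, ∀ b < 2 * m, ∀ x y, Q a x y → ∃ z, Q b x z)
    (hsymm : ∀ a < 2 * m, ∀ x y, Q a x y → Q a y x)
    (hirr : ∀ a < 2 * m, ∀ x, ¬ Q a x x)
    (hF : ∀ q < 2 * m + 1, ∀ x y, F q x → F q y → x = y)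
    (hcov : ∀ a < 2 * m, ∀ x y, Q a x y → ∃ q < 2 * m + 1, F q x) : False := by
  classical
  let X : Set U := {x | ∃ y, Q 0 x y}
  have h0 : 0 < 2 * m := by omega
  have hX : ∀ a < 2 * m, ∀ x y, Q a x y → x ∈ X := fun a ha x y h => hex a ha 0 h0 x y h
  choose q hq hq' using fun x : X => hcov 0 h0 x.1 _ x.2.choose_spec
  let ι : X → Fin (2 * m + 1) := fun x => ⟨q x, hq x⟩
  have hι : Injective ι := fun x y h => Subtype.ext
    (hF _ (hq x) _ _ (hq' x) (by rw [show q x = q y from congrArg Fin.val h]; exact hq' y))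
  have : Finite X := Finite.of_injective ι hι
  have := Fintype.ofFinite X
  have hle : Fintype.card X ≤ 2 * m + 1 := by simpa using Fintype.card_le_of_injective ι hι
  have hf : ∀ (a : Fin (2 * m)) (x : X), ∃ y : X, Q a x y := fun a x => by
    obtain ⟨y, hy⟩ := x.2
    obtain ⟨z, hz⟩ := hex 0 h0 a a.2 _ _ hy
    exact ⟨⟨z, hX a a.2 _ _ (hsymm a a.2 _ _ hz)⟩, hz⟩
  choose f hf using hf
  -- A point together with one neighbour of each colour gives `2 * m + 1` different points, so these
  -- exhaust the domain and neighbours are unique.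
  let g : X → Option (Fin (2 * m)) → X := fun x o => o.elim x fun a => f a x
  have hg : ∀ x, Injective (g x) := by
    rintro x (_ | a) (_ | b) h
    · rfl
    · have := hf b x
      rw [← show x = f b x from h] at this
      exact (hirr _ b.2 _ this).elim
    · have := hf a x
      rw [show f a x = x from h] at this
      exact (hirr _ a.2 _ this).elim
    · have := hf a x
      rw [show f a x = f b x from h] at this
      exact congrArg some (Fin.ext (hdisj a a.2 b b.2 _ _ this (hf b x)))
  obtain ⟨x, y, hxy⟩ := hne
  have hcard : Fintype.card X = 2 * m + 1 := by
    refine le_antisymm hle ?_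
    simpa using Fintype.card_le_of_injective _ (hg ⟨x, y, hxy⟩)
  have hsurj : ∀ x, Surjective (g x) := fun x =>
    ((Fintype.bijective_iff_injective_and_card _).2 ⟨hg x, by simp [hcard]⟩).2
  have huniq : ∀ x y : X, Q 0 x y → y = f ⟨0, h0⟩ x := by
    intro x y h
    obtain ⟨_ | a, rfl⟩ := hsurj x y
    · exact (hirr 0 h0 _ h).elim
    · have : a = ⟨0, h0⟩ := Fin.ext (hdisj a a.2 0 h0 _ _ (hf a x) h)
      rw [this]
      rfl
  -- The relation `Q 0` is now the graph of an involution without fixed points on a set of odd size.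
  have hsum : ∑ _x : X, (1 : ZMod 2) = 0 := by
    refine Finset.sum_involution (fun x _ => f ⟨0, h0⟩ x) (fun _ _ => by decide) ?_ (by simp) ?_
    · intro x _ _ h
      have := hf ⟨0, h0⟩ x
      rw [h] at this
      exact hirr 0 h0 _ this
    · intro x _
      exact (huniq _ _ (hsymm 0 h0 _ _ (hf ⟨0, h0⟩ x))).symm
  have h2 : ((2 : ℕ) : ZMod 2) = 0 := ZMod.natCast_self 2
  simp only [Finset.sum_const, Finset.card_univ, hcard, nsmul_eq_mul, mul_one, Nat.cast_add,
    Nat.cast_mul, h2, zero_mul, zero_add, Nat.cast_one] at hsum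
  exact one_ne_zero hsum

/-! ### Derived terms and their values -/

namespace PTerm

variable {α : ℕ}

def mul (s t : PTerm α) : PTerm α := neg (add (neg s) (neg t))

/-- The term `s · -t`. -/
def diff (s t : PTerm α) : PTerm α := mul s (neg t)

def sum (z : PTerm α) (l : List (PTerm α)) : PTerm α := l.foldr add z

def cylAll (l : List (Fin α)) (t : PTerm α) : PTerm α := l.foldr cyl t

section Eval

variable {U : Type v} {I : Type u} {k : ℕ → (Fin α → U) → I → Prop} {s t z : PTerm α}
  {x : Fin α → U} {a : I}

theorem eval_add : (add s t).eval (tagAlg α U I) k x a ↔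
    s.eval (tagAlg α U I) k x a ∨ t.eval (tagAlg α U I) k x a := Iff.rfl

theorem eval_neg : (neg s).eval (tagAlg α U I) k x a ↔ ¬ s.eval (tagAlg α U I) k x a := Iff.rfl

theorem eval_mul : (mul s t).eval (tagAlg α U I) k x a ↔
    s.eval (tagAlg α U I) k x a ∧ t.eval (tagAlg α U I) k x a := by
  rw [mul, eval_neg, eval_add, eval_neg, eval_neg]
  tauto

theorem eval_diff : (diff s t).eval (tagAlg α U I) k x a ↔
    s.eval (tagAlg α U I) k x a ∧ ¬ t.eval (tagAlg α U I) k x a := by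
  rw [diff, eval_mul, eval_neg]

theorem eval_cyl {i : Fin α} : (cyl i s).eval (tagAlg α U I) k x a ↔
    ∃ u b, s.eval (tagAlg α U I) k (update x i u) b := Iff.rfl

theorem eval_diag {i j : Fin α} : (diag i j).eval (tagAlg α U I) k x a ↔ x i = x j := Iff.rfl

theorem eval_transp {i j : Fin α} : (transp i j s).eval (tagAlg α U I) k x a ↔
    s.eval (tagAlg α U I) k (fun l => x (Equiv.swap i j l)) a := Iff.rfl

theorem eval_var {n : ℕ} : (var n).eval (tagAlg α U I) k x a ↔ k n x a := Iff.rfl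

theorem eval_sum {l : List (PTerm α)} : (sum z l).eval (tagAlg α U I) k x a ↔
    (∃ t ∈ l, t.eval (tagAlg α U I) k x a) ∨ z.eval (tagAlg α U I) k x a := by
  induction l with
  | nil => simp [sum]
  | cons t l ih =>
    rw [sum, List.foldr_cons, eval_add, ← sum, ih]
    simp [or_assoc]

/-- At least one cylindrification is needed, since the tag may change as well. -/
theorem eval_cylAll_of {l : List (Fin α)} {y : Fin α → U} {b : I}
    (h : t.eval (tagAlg α U I) k y b) (hxy : ∀ i ∉ l, x i = y i) (hl : l ≠ []) :
    (cylAll l t).eval (tagAlg α U I) k x a := by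
  induction l generalizing x a with
  | nil => exact (hl rfl).elim
  | cons i l ih =>
    refine ⟨y i, b, ?_⟩
    have hxy' : ∀ j ∉ l, update x i (y i) j = y j := fun j hj => by
      by_cases hji : j = i
      · subst hji; simp
      · rw [update_of_ne hji]
        exact hxy j (by simp [hji, hj])
    by_cases hl : l = []
    · subst hl
      have : update x i (y i) = y := funext fun j => hxy' j (by simp)
      rw [this]
      exact h
    · exact ih hxy' hl

theorem exists_of_eval_cylAll {l : List (Fin α)} (h : (cylAll l t).eval (tagAlg α U I) k x a) :
    ∃ y b, t.eval (tagAlg α U I) k y b := by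
  induction l generalizing x a with
  | nil => exact ⟨x, a, h⟩
  | cons i l ih =>
    obtain ⟨u, b, h⟩ := h
    exact ih h

end Eval

end PTerm

open PTerm

/-! ### The parity equation and its truth in set algebras -/

section Equation

variable {α : ℕ} (i₀ i₁ i₂ : Fin α) (m : ℕ)

/-- The function `x_(2 * m + q)`, which maps the coordinate `i₁` to at most one vertex. -/
def vertexAt (q : ℕ) : PTerm α := cyl i₂ (var (2 * m + q))

/-- Some value of the coordinate `i₁` enumerates the domain of `x_a`. -/
def enumerated (a : ℕ) : PTerm α :=
  cyl i₁ (neg (cyl i₀ (diff (cyl i₁ (var a))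
    (sum (neg (diag i₀ i₀)) ((List.range (2 * m + 1)).map (vertexAt i₂ m))))))

/-- The terms whose vanishing says that the `x_a`, `a < 2 * m`, are a symmetric partition of a
relation with a domain of at most `2 * m + 1` elements. -/
def obstructions : List (PTerm α) :=
  (List.range (2 * m)).flatMap (fun a => [
      diff (var a) (transp i₀ i₁ (var a)), mul (var a) (diag i₀ i₁),
      diff (var a) (enumerated i₀ i₁ i₂ m a)] ++
    (List.range (2 * m)).flatMap fun b =>
      diff (var a) (cyl i₁ (var b)) :: if a = b then [] else [mul (var a) (var b)]) ++
  (List.range (2 * m + 1)).map fun q =>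
    diff (mul (vertexAt i₂ m q) (cyl i₀ (mul (diag i₀ i₂) (vertexAt i₂ m q)))) (diag i₀ i₂)

/-- The equation saying that there is no symmetric partition into `2 * m` parts of a relation
with a domain of at most `2 * m + 1` elements. -/
def parityEquation : Equation α where
  lhs := diff (var 0) (cylAll (List.finRange α)
    (sum (neg (diag i₀ i₀)) (obstructions i₀ i₁ i₂ m)))
  rhs := neg (diag i₀ i₀)

variable {i₀ i₁ i₂ m}

theorem forall_obstructions {P : PTerm α → Prop} : (∀ t ∈ obstructions i₀ i₁ i₂ m, P t) ↔
    (∀ a < 2 * m, P (diff (var a) (transp i₀ i₁ (var a)))) ∧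
    (∀ a < 2 * m, P (mul (var a) (diag i₀ i₁))) ∧
    (∀ a < 2 * m, P (diff (var a) (enumerated i₀ i₁ i₂ m a))) ∧
    (∀ a < 2 * m, ∀ b < 2 * m, P (diff (var a) (cyl i₁ (var b)))) ∧
    (∀ a < 2 * m, ∀ b < 2 * m, a ≠ b → P (mul (var a) (var b))) ∧
    (∀ q < 2 * m + 1, P (diff (mul (vertexAt i₂ m q)
      (cyl i₀ (mul (diag i₀ i₂) (vertexAt i₂ m q)))) (diag i₀ i₂))) := by
  have hite : ∀ (a b : ℕ) (t : PTerm α),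
      t ∈ (if a = b then [] else [mul (var a) (var b)] : List (PTerm α)) ↔
        a ≠ b ∧ t = mul (var a) (var b) := by
    intro a b t
    split_ifs with h <;> simp [h]
  simp only [obstructions, List.mem_append, List.mem_flatMap, List.mem_range, List.mem_cons,
    List.mem_map, List.not_mem_nil, or_false, hite]
  constructor
  · intro h
    refine ⟨fun a ha => h _ (Or.inl ⟨a, ha, Or.inl (Or.inl rfl)⟩),
      fun a ha => h _ (Or.inl ⟨a, ha, Or.inl (Or.inr (Or.inl rfl))⟩),
      fun a ha => h _ (Or.inl ⟨a, ha, Or.inl (Or.inr (Or.inr rfl))⟩),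
      fun a ha b hb => h _ (Or.inl ⟨a, ha, Or.inr ⟨b, hb, Or.inl rfl⟩⟩),
      fun a ha b hb hab => h _ (Or.inl ⟨a, ha, Or.inr ⟨b, hb, Or.inr ⟨hab, rfl⟩⟩⟩),
      fun q hq => h _ (Or.inr ⟨q, hq, rfl⟩)⟩
  · rintro ⟨h1, h2, h3, h4, h5, h6⟩ t
      (⟨a, ha, (rfl | rfl | rfl) | ⟨b, hb, rfl | ⟨hab, rfl⟩⟩⟩ | ⟨q, hq, rfl⟩)
    exacts [h1 a ha, h2 a ha, h3 a ha, h4 a ha b hb, h5 a ha b hb hab, h6 q hq]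

/-- Cylindrifying all coordinates turns a nonempty obstruction into the unit. If the left side is
nonempty, all obstructions are therefore empty, and fixing the coordinates other than `i₀` and `i₁`
yields binary relations that contradict the parity argument. -/
theorem parityEquation_trueInSets (hm : 1 ≤ m) (h01 : i₀ ≠ i₁) (h02 : i₀ ≠ i₂) (h12 : i₁ ≠ i₂) :
    Equation.TrueInSets.{u} (parityEquation i₀ i₁ i₂ m) := by
  intro U _ k
  funext s x
  obtain ⟨⟩ := x
  refine propext ⟨fun h => ?_, fun h => (h rfl).elim⟩
  exfalso
  obtain ⟨h0, hno⟩ := eval_diff.1 h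
  have hno : ∀ t ∈ obstructions i₀ i₁ i₂ m, ∀ y, ¬ t.eval (tagAlg α U PUnit) k y ⟨⟩ :=
    fun t ht y hy => hno (eval_cylAll_of (eval_sum.2 (Or.inl ⟨t, ht, hy⟩)) (by simp)
      (List.ne_nil_of_mem (List.mem_finRange i₀)))
  rw [forall_obstructions] at hno
  obtain ⟨hsymm, hirr, henum, hex, hdisj, hfun⟩ := hno
  simp only [eval_diff, eval_mul, eval_diag, eval_transp, not_and, not_not] at *
  let pt : U → U → Fin α → U := fun x y => update (update s i₀ x) i₁ y
  have hpt1 : ∀ x y z, update (pt x y) i₁ z = pt x z := fun x y z => update_idem ..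
  have hpt0 : ∀ x y z, update (pt x y) i₀ z = pt z y := fun x y z => by
    simp only [pt]
    rw [update_comm h01.symm, update_idem, update_comm h01]
  have hp0 : ∀ x y, pt x y i₀ = x := fun x y => by simp [pt, h01]
  have hp1 : ∀ x y, pt x y i₁ = y := fun x y => by simp [pt]
  have hswap : ∀ x y, (fun l => pt x y (Equiv.swap i₀ i₁ l)) = pt y x := fun x y => by
    funext l
    by_cases hl0 : l = i₀
    · subst hl0; rw [Equiv.swap_apply_left, hp1, hp0]
    · by_cases hl1 : l = i₁
      · subst hl1; rw [Equiv.swap_apply_right, hp1, hp0]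
      · rw [Equiv.swap_apply_of_ne_of_ne hl0 hl1]
        simp [pt, hl0, hl1]
  have hs : pt (s i₀) (s i₁) = s := by simp [pt]
  have h2m : 0 < 2 * m := by omega
  obtain ⟨t, ⟨⟩, ht⟩ := henum 0 h2m s h0
  have ht : ∀ x, (∃ y, k 0 (pt x y) ⟨⟩) →
      ∃ q < 2 * m + 1, (vertexAt i₂ m q).eval (tagAlg α U PUnit) k (pt x t) ⟨⟩ := by
    rintro x ⟨y, hy⟩
    by_contra hcon
    refine ht ⟨x, ⟨⟩, eval_diff.2 ⟨⟨y, ⟨⟩, ?_⟩, fun h => hcon ?_⟩⟩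
    · rw [← hs, hpt1, hpt0, hpt1]
      exact hy
    · rw [← hs, hpt1, hpt0, eval_sum] at h
      obtain ⟨q', hq', h⟩ | h := h
      · obtain ⟨q, hq, rfl⟩ := List.mem_map.1 hq'
        exact ⟨q, List.mem_range.1 hq, h⟩
      · exact (h rfl).elim
  refine false_of_symmetric_partition (Q := fun a x y => k a (pt x y) ⟨⟩)
    (F := fun q x => (vertexAt i₂ m q).eval (tagAlg α U PUnit) k (pt x t) ⟨⟩)
    ⟨s i₀, s i₁, by rw [hs]; exact h0⟩ hm ?_ ?_ ?_ ?_ ?_ ?_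
  · intro a ha b hb x y h h'
    by_contra hab
    exact hdisj a ha b hb hab _ h h'
  · intro a ha b hb x y h
    obtain ⟨z, ⟨⟩, hz⟩ := hex a ha b hb _ h
    rw [hpt1] at hz
    exact ⟨z, hz⟩
  · intro a ha x y h
    have := hsymm a ha _ h
    rw [hswap] at this
    exact this
  · intro a ha x h
    exact hirr a ha _ h (by rw [hp0, hp1])
  · intro q hq x y hx hy
    -- `vertexAt` does not depend on the coordinate `i₂`, which is free to hold the second candidate
    -- `y` for the coordinate `i₀`.
    have hu : ∀ z w, (vertexAt i₂ m q).eval (tagAlg α U PUnit) k (pt z t) ⟨⟩ →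
        (vertexAt i₂ m q).eval (tagAlg α U PUnit) k (update (pt z t) i₂ w) ⟨⟩ := by
      rintro z w ⟨u, ⟨⟩, h⟩
      exact ⟨u, ⟨⟩, by rwa [update_idem]⟩
    have := hfun q hq (update (pt x t) i₂ y) ⟨hu _ _ hx, y, ⟨⟩, eval_mul.2 ⟨?_, ?_⟩⟩
    · rwa [update_of_ne h02, update_self, hp0] at this
    · rw [eval_diag, update_self, update_of_ne h02.symm, update_self]
    · rw [update_comm h02.symm, hpt0]
      exact hu _ _ hy
  · intro a ha x y h
    obtain ⟨z, ⟨⟩, hz⟩ := hex a ha 0 h2m _ h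
    rw [hpt1] at hz
    exact ht x ⟨z, hz⟩

end Equation

/-! ### Failure of the parity equation in the tame algebra -/

namespace Pt

variable {m α : ℕ}

/-- An evaluation refuting the parity equation: the splittable sequences starting with two
vertices are partitioned by their tags. -/
def witness (i₀ i₁ : Fin α) (n : ℕ) : (Fin α → Pt m) → ZMod (2 * m) → Prop :=
  if n < 2 * m then
    fun s a => Splittable s ∧ (s i₀).IsVertex ∧ (s i₁).IsVertex ∧ a = n
  else fun s _ => ∃ x g, s i₀ = vertex x ∧ s i₁ = perm g ∧ g ((n - 2 * m : ℕ) : ZMod _) = x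

theorem witness_of_lt {i₀ i₁ : Fin α} {n : ℕ} (h : n < 2 * m) (s : Fin α → Pt m)
    (a : ZMod (2 * m)) : witness i₀ i₁ n s a ↔
      Splittable s ∧ (s i₀).IsVertex ∧ (s i₁).IsVertex ∧ a = n := by
  rw [witness, if_pos h]

theorem witness_add {i₀ i₁ : Fin α} {n : ℕ} (s : Fin α → Pt m)
    (a : ZMod (2 * m)) : witness i₀ i₁ (2 * m + n) s a ↔
      ∃ x g, s i₀ = vertex x ∧ s i₁ = perm g ∧ g (n : ZMod _) = x := by
  rw [witness, if_neg (by omega), Nat.add_sub_cancel_left]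

/-- No single vertex is invariant under the action. Enumerating the vertices relative to a point
`perm f` is, since the action multiplies `f` on the left. -/
theorem tame_witness (i₀ i₁ : Fin α) (n : ℕ) : Tame Eq (witness (m := m) i₀ i₁ n) := by
  refine ⟨fun g h s a => ?_, fun s hs a b => ?_, fun s a b hab => by rw [hab]⟩
  · unfold witness
    split_ifs
    · simp only [splittable_act, comp_apply, isVertex_act]
    · constructor
      · rintro ⟨x, f, h1, h2, h3⟩
        refine ⟨g⁻¹ x, g⁻¹ * f, act_injective g h ?_, act_injective g h ?_, ?_⟩
        · rw [comp_apply] at h1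
          rw [h1]; simp [act]
        · rw [comp_apply] at h2
          rw [h2]; simp [act]
        · simp [h3]
      · rintro ⟨x, f, h1, h2, h3⟩
        exact ⟨g x, g * f, by rw [comp_apply, h1, act], by rw [comp_apply, h2, act], by simp [h3]⟩
  · unfold witness
    split_ifs
    · exact iff_of_false (fun h => hs h.1) (fun h => hs h.1)
    · rfl

/-- All pieces lie over the same sequences and differ only in the tag, so each is symmetric, and
cylindrifying one piece covers all the others. -/
theorem not_obstructed {i₀ i₁ i₂ : Fin α} (h01 : i₀ ≠ i₁) (h02 : i₀ ≠ i₂) (h12 : i₁ ≠ i₂) :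
    ∀ t ∈ obstructions i₀ i₁ i₂ m, ∀ s a,
      ¬ t.eval (tagAlg α (Pt m) (ZMod (2 * m))) (witness i₀ i₁) s a := by
  have hF (q : ℕ) (s : Fin α → Pt m) (a : ZMod (2 * m)) :
      (vertexAt i₂ m q).eval (tagAlg α (Pt m) (ZMod (2 * m))) (witness i₀ i₁) s a ↔
      ∃ x g, s i₀ = vertex x ∧ s i₁ = perm g ∧ g (q : ZMod _) = x := by
    refine eval_cyl.trans ?_
    simp only [eval_var, witness_add, update_of_ne h02, update_of_ne h12]
    exact ⟨fun ⟨_, _, h⟩ => h, fun h => ⟨s i₀, a, h⟩⟩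
  rw [forall_obstructions]
  simp only [eval_diff, eval_mul, eval_diag, eval_transp, eval_var, not_and, not_not]
  refine ⟨fun a ha s b h => ?_, fun a ha s b h heq => ?_, fun a ha s b h => ?_,
    fun a ha b hb s c h => ?_, fun a ha b hb hab s c h h' => ?_, fun q hq s c ⟨h, h'⟩ => ?_⟩
  · rw [witness_of_lt ha] at h ⊢
    refine ⟨h.1.swap _ _, ?_, ?_, h.2.2.2⟩
    · rw [Equiv.swap_apply_left]; exact h.2.2.1
    · rw [Equiv.swap_apply_right]; exact h.2.1
  · rw [witness_of_lt ha] at h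
    exact h01 (h.1.1 heq)
  -- Relative to the identity permutation, the vertex `x` has the number `x.val`.
  · refine eval_cyl.2 ⟨perm 1, b, ?_⟩
    rintro ⟨u, c, h'⟩
    obtain ⟨⟨w, d, h'⟩, h2⟩ := eval_diff.1 h'
    rw [eval_var, witness_of_lt ha] at h'
    obtain ⟨x, hx⟩ := h'.2.1.exists_eq
    rw [update_of_ne h01, update_self] at hx
    refine h2 (eval_sum.2 (Or.inl ⟨_, List.mem_map.2 ⟨x.val, List.mem_range.2 x.val_lt, rfl⟩, ?_⟩))
    rw [hF]
    exact ⟨x, 1, by rw [update_self, hx], by rw [update_of_ne h01.symm, update_self], by simp⟩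
  · rw [witness_of_lt ha] at h
    refine ⟨s i₁, b, ?_⟩
    rw [update_eq_self, eval_var, witness_of_lt hb]
    exact ⟨h.1, h.2.1, h.2.2.1, rfl⟩
  · rw [witness_of_lt ha] at h
    rw [witness_of_lt hb] at h'
    have := h.2.2.2.symm.trans h'.2.2.2
    rw [ZMod.natCast_eq_natCast_iff', Nat.mod_eq_of_lt ha, Nat.mod_eq_of_lt hb] at this
    exact hab this
  · rw [hF] at h
    obtain ⟨u, b, h'⟩ := h'
    rw [eval_mul, eval_diag, hF, update_self, update_of_ne h02.symm, update_of_ne h01.symm] at h'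
    obtain ⟨x, g, h1, h2, h3⟩ := h
    obtain ⟨h4, x', g', h1', h2', h3'⟩ := h'
    rw [h2] at h2'
    cases h2'
    rw [h1, ← h4, h1', ← h3, h3']

theorem exists_witness {i₀ i₁ : Fin α} (h01 : i₀ ≠ i₁) (hm : 1 ≤ m) :
    ∃ s, witness (m := m) i₀ i₁ 0 s 0 := by
  have h1 : (1 : ZMod (2 * m + 1)) ≠ 0 := by
    simpa using natCast_ne_zero (m := m) (n := 1) le_rfl (by omega)
  let s : Fin α → Pt m := fun l => if l = i₀ then vertex 0 else if l = i₁ then vertex 1 else aux l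
  refine ⟨s, (witness_of_lt (by omega) _ _).2 ⟨⟨fun a b hab => ?_, fun l => ?_, i₀, i₁, h01,
    fun l => ?_⟩, ?_, ?_, by simp⟩⟩
  · simp only [s] at hab
    split_ifs at hab <;> simp_all [Fin.ext_iff]
  · simp only [s]
    split_ifs <;> exact id
  · simp only [s]
    split_ifs <;> simp_all [IsVertex]
  · simp [s, IsVertex]
  · simp [s, h01.symm, IsVertex]

theorem parityEquation_fails {i₀ i₁ i₂ : Fin α} (h01 : i₀ ≠ i₁) (h02 : i₀ ≠ i₂) (h12 : i₁ ≠ i₂)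
    (hm : 1 ≤ m) : (parityEquation i₀ i₁ i₂ m).lhs.eval (tagAlg α (Pt m) (ZMod (2 * m)))
      (witness i₀ i₁) ≠ (parityEquation i₀ i₁ i₂ m).rhs.eval (tagAlg α (Pt m) (ZMod (2 * m)))
      (witness i₀ i₁) := by
  intro h
  obtain ⟨s, hs⟩ := exists_witness (m := m) h01 hm
  have := (congrFun (congrFun h s) 0).mp (eval_diff.2 ⟨hs, fun hc => ?_⟩)
  · exact this rfl
  · obtain ⟨y, b, hy⟩ := exists_of_eval_cylAll hc
    obtain ⟨t, ht, hy⟩ | hy := eval_sum.1 hy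
    · exact not_obstructed h01 h02 h12 t ht y b hy
    · exact hy rfl

/-! ### True equations of restricted form hold in the tame algebra -/

variable {e : Equation α} {k : ℕ → (Fin α → Pt m) → ZMod (2 * m) → Prop}

/-- Each point is replaced by `2 * m` copies indexed by `ZMod (2 * m)`. The sum of the indices is a
symmetric colouring, and changing the copy in one coordinate gives it any value. -/
theorem eval_eq_of_not_hasDiag (he : Equation.TrueInSets.{u} e) (hα : 0 < α)
    (hk : ∀ n, Tame Eq (k n)) (hd : ¬ e.HasDiag) :
    e.lhs.eval (tagAlg α (Pt m) (ZMod (2 * m))) k =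
      e.rhs.eval (tagAlg α (Pt m) (ZMod (2 * m))) k := by
  have : Nonempty (ULift.{u} (Pt m × ZMod (2 * m))) := ⟨⟨aux 0, 0⟩⟩
  refine eval_eq_of_fits (closed_tame Eq) he hα (U' := ULift.{u} (Pt m × ZMod (2 * m)))
    (π := fun p => p.down.1) (fun p => ⟨⟨p, 0⟩, rfl⟩) (χ := fun s => ∑ l, (s l).down.2)
    (fun n _ => hk n) (fits_of_coloring fun s hs i a => ?_) (fun h => (hd h).elim)
    (fun _ i j s => Equiv.sum_comp (Equiv.swap i j) fun l => (s l).down.2)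
  have hπ : ∀ c : ZMod (2 * m), ∀ l,
      (update s i ⟨(s i).down.1, c⟩ l).down.1 = (s l).down.1 := fun c l => by
    by_cases hl : l = i
    · subst hl; rw [update_self]
    · rw [update_of_ne hl]
  refine ⟨⟨(s i).down.1, a - ∑ l ∈ Finset.univ.erase i, (s l).down.2⟩, ?_, fun l => ?_, ?_⟩
  · convert hs using 1
    exact funext (hπ _)
  · rw [hπ]
  · set c := a - ∑ l ∈ Finset.univ.erase i, (s l).down.2 with hc
    have hrest : ∑ l ∈ Finset.univ.erase i, (update s i ⟨(s i).down.1, c⟩ l).down.2 =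
        ∑ l ∈ Finset.univ.erase i, (s l).down.2 :=
      Finset.sum_congr rfl fun l hl => by rw [update_of_ne (Finset.ne_of_mem_erase hl)]
    rw [← Finset.add_sum_erase _ _ (Finset.mem_univ i), update_self, hrest, hc, sub_add_cancel]

theorem fits_down {I : Type} {r : I → I → Prop} {χ : (Fin α → Pt m) → I}
    (h : ∀ s, Splittable s → ∀ i a, ∃ p, Splittable (update s i p) ∧
      (∀ l, (update s i p l).IsVertex ↔ (s l).IsVertex) ∧ r a (χ (update s i p))) :
    Fits (ULift.down.{u}) (fun s => χ (ULift.down ∘ s)) (Tame r) := by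
  refine fits_of_coloring fun s hs i a => ?_
  obtain ⟨p, h1, h2, h3⟩ := h _ hs i a
  refine ⟨⟨p⟩, ?_, fun l => ?_, ?_⟩
  · rwa [comp_update]
  · rw [← comp_apply (f := ULift.down), comp_update]
    exact h2 l
  · rwa [comp_update]

theorem eval_eq_of_not_hasTransp (he : Equation.TrueInSets.{u} e) (hα : 0 < α) (hm : 1 ≤ m)
    (hk : ∀ n, Tame Eq (k n)) (hp : ¬ e.HasTransp) :
    e.lhs.eval (tagAlg α (Pt m) (ZMod (2 * m))) k =
      e.rhs.eval (tagAlg α (Pt m) (ZMod (2 * m))) k := by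
  have : Nonempty (ULift.{u} (Pt m)) := ⟨⟨aux 0⟩⟩
  obtain ⟨χ, hχ⟩ := exists_latin_coloring (α := α) hm
  exact eval_eq_of_fits (closed_tame Eq) he hα ULift.down_surjective
    (χ := fun s => χ (ULift.down ∘ s)) (fun n _ => hk n)
    (fits_down fun s hs i a => by simpa only [eq_comm] using hχ s hs i a)
    (fun _ => ULift.down_injective) (fun h => (hp h).elim)

theorem eval_eq_of_card_vars_lt (he : Equation.TrueInSets.{u} e) (hα : 0 < α) (hm : 1 ≤ m)
    (hk : ∀ n, Tame Eq (k n)) (hc : (2 ^ 2 ^ α) ^ e.vars.card ≤ m) :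
    e.lhs.eval (tagAlg α (Pt m) (ZMod (2 * m))) k =
      e.rhs.eval (tagAlg α (Pt m) (ZMod (2 * m))) k := by
  classical
  have : Nonempty (ULift.{u} (Pt m)) := ⟨⟨aux 0⟩⟩
  have : NeZero m := ⟨by omega⟩
  -- Tags are identified if the evaluated variables do not distinguish them. By homogeneity it
  -- suffices that, for each variable, the same sets of vertex positions occur, which leaves at most
  -- `2 ^ 2 ^ α` possibilities per variable.
  let r : ZMod (2 * m) → ZMod (2 * m) → Prop := fun a b => ∀ n ∈ e.vars, ∀ s, k n s a ↔ k n s b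
  let sig : ZMod (2 * m) → e.vars → Set (Set (Fin α)) := fun a n =>
    {P | ∃ s, Splittable s ∧ (∀ l, l ∈ P ↔ (s l).IsVertex) ∧ k n s a}
  have hsig : ∀ a b, sig a = sig b → r a b := by
    have key : ∀ a b, sig a = sig b → ∀ n ∈ e.vars, ∀ s, k n s a → k n s b := by
      intro a b hab n hn s hs
      by_cases hsp : Splittable s
      · have : {l | (s l).IsVertex} ∈ sig a ⟨n, hn⟩ := ⟨s, hsp, fun l => Iff.rfl, hs⟩
        rw [hab] at this
        obtain ⟨s', h1, h2, h3⟩ := this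
        obtain ⟨g, h, rfl⟩ := h1.exists_act_eq hsp h2
        exact ((hk n).act g h s' b).2 h3
      · exact ((hk n).tag s hsp a b).1 hs
    exact fun a b hab n hn s => ⟨key a b hab n hn s, key b a hab.symm n hn s⟩
  obtain ⟨ι⟩ : Nonempty ((e.vars → Set (Set (Fin α))) ↪ ZMod m) := by
    refine Function.Embedding.nonempty_of_card_le ?_
    simpa [ZMod.card] using hc
  obtain ⟨χ, hsymm, hχ⟩ := exists_symmetric_coloring (α := α) hm
  -- A colour is sent to a tag representing its class; colours that code no class get an arbitrary
  -- tag.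
  let ρ : ZMod m → ZMod (2 * m) := invFun (ι ∘ sig)
  have hρ : ∀ a, r a (ρ (ι (sig a))) := fun a =>
    hsig _ _ (ι.injective (invFun_eq (f := ι ∘ sig) ⟨a, rfl⟩).symm)
  refine eval_eq_of_fits (closed_tame r) he hα ULift.down_surjective
    (χ := fun s => ρ (χ (ULift.down ∘ s)))
    (fun n hn => ⟨(hk n).act, (hk n).tag, fun s a b hab => hab n hn s⟩)
    (fits_down (χ := fun s => ρ (χ s)) fun s hs i a => ?_)
    (fun _ => ULift.down_injective) (fun _ i j s => congrArg ρ (hsymm i j (ULift.down ∘ s)))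
  obtain ⟨p, h1, h2, h3⟩ := hχ s hs i (ι (sig a))
  exact ⟨p, h1, h2, by rw [h3]; exact hρ a⟩

end Pt

/-! ### The main theorem -/

/-- Every equational axiom system for the tautological algebra contains, for each `n`, an equation
with at least `n` variables, a transposition, a cylindrification and a diagonal constant. -/
theorem IsEquationalAxiomSystem.exists_complex_equation {α : ℕ} (hα : 3 ≤ α) {R : Type u}
    {ar : R → ℕ} (hinf : {r : R | ar r = α}.Infinite) {E : Set (Equation α)}
    (hE : IsEquationalAxiomSystem (Fm.tautologicalAlgebra α ar) E) (n : ℕ) :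
    ∃ e ∈ E, n ≤ e.vars.card ∧ e.HasTransp ∧ e.HasCyl ∧ e.HasDiag := by
  by_contra hcon
  -- This bounds the number of classes of tags that fewer than `n` variables can distinguish.
  let m := (2 ^ 2 ^ α) ^ n
  have hm : 1 ≤ m := Nat.one_le_pow _ _ (by positivity)
  let i₀ : Fin α := ⟨0, by omega⟩
  let i₁ : Fin α := ⟨1, by omega⟩
  let i₂ : Fin α := ⟨2, by omega⟩
  have h01 : i₀ ≠ i₁ := by simp [i₀, i₁]
  have h02 : i₀ ≠ i₂ := by simp [i₀, i₂]
  have h12 : i₁ ≠ i₂ := by simp [i₁, i₂]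
  have hder := hE.2 (parityEquation i₀ i₁ i₂ m)
    (Fm.trueIn_tautologicalAlgebra_of_trueInSets (parityEquation_trueInSets hm h01 h02 h12))
  refine Pt.parityEquation_fails h01 h02 h12 hm
    (hder.sound (Pt.closed_tame (m := m) Eq) (fun e he k hk => ?_) _ (Pt.tame_witness i₀ i₁))
  have hset := Fm.trueInSets_of_trueIn_tautologicalAlgebra hinf (hE.1 e he)
  have : Nonempty (ULift (Pt m)) := ⟨⟨Pt.aux 0⟩⟩
  by_cases hc : e.HasCyl
  · by_cases hd : e.HasDiag
    · by_cases hp : e.HasTransp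
      · have hlt : ¬ n ≤ e.vars.card := fun hn => hcon ⟨e, he, hn, hp, hc, hd⟩
        exact Pt.eval_eq_of_card_vars_lt hset (by omega) hm hk
          (Nat.pow_le_pow_right (by positivity) (by omega))
      · exact Pt.eval_eq_of_not_hasTransp hset (by omega) hm hk hp
    · exact Pt.eval_eq_of_not_hasDiag hset (by omega) hk hd
  · exact eval_eq_of_not_hasCyl (Pt.closed_tame Eq) hset (π := ULift.down) ULift.down_bijective
      (fun n _ => hk n) hc

end PolyLogic

theorem theorem1 (α : ℕ) (hα : 3 ≤ α) {R : Type*} (ar : R → ℕ)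
    (har : ∀ r, ar r ≤ α) (hinf : {r : R | ar r = α}.Infinite)
    (E : Set (PolyLogic.Equation α))
    (hE : PolyLogic.IsEquationalAxiomSystem (PolyLogic.Fm.tautologicalAlgebra α ar) E)
    (n : ℕ) :
    ∃ e ∈ E, n ≤ e.vars.card ∧ e.HasTransp ∧ e.HasCyl ∧ e.HasDiag :=
  hE.exists_complex_equation hα hinf n
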